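/- Let $\mathcal X$ and $\mathcal W$ be Polish spaces with their Borel $\sigma$-algebras, let $f:\mathcal X\times\mathcal W\to\mathcal X$ be Borel measurable, and consider the system $X_{k+1}=f(X_k,W_k)$, $k=0,1,2,\dots$, driven by a random initial state $X_0$ and a random noise sequence $W=(W_k)_{k\ge 0}$ with an arbitrary joint law. Write $P_k$ for the law of $X_k$, $W_{s:t-1}=(W_s,\dots,W_{t-1})$, and $Y_{0:k-1}=(X_0,W_0,\dots,W_{k-1})$ (so that $Y_{0:-1}=X_0$). Let $R$ be a probability measure on $\mathcal W$ (the nominal law of each $W_k$), and let $P_*$ be a probability measure on $\mathcal X$ that is invariant under the nominal noise: $P_*=(P_*\times R)\circ f^{-1}$. The noise is called admissible if, for all $0\le s<t$, the conditional law $\mathsf P_{W_{s:t-1}\mid X_s}(\cdot\mid x)$ is absolutely continuous with respect to $R^{t-s}$ for $P_s$-almost all $x$. For an admissible noise, the conditional relative entropy supply over $[s,t)$ is $$E_{s,t}=\int_{\mathcal X}\mathbf D_0\big(\mathsf P_{W_{s:t-1}\mid X_s}(\cdot\mid x)\,\big\|\,R^{t-s}\big)\,P_s(dx)\in[0,\infty],$$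 where $\mathbf D_0$ is the relative entropy (Kullback–Leibler divergence). For probability measures $\Phi,\Psi\ll P_*$ on $\mathcal X$ and $t>0$, the minimum required supply $J_t(\Phi,\Psi)$ is the infimum of $E_{0,t}$ over all admissible noises with $P_0=\Phi$ and $P_t=\Psi$ (the infimum over the empty set is $+\infty$). $\Psi$ is called reachable from $\Phi$ in time $t$ if $J_t(\Phi,\Psi)<\infty$. **Theorem.** Let $\Phi,\Psi\ll P_*$ be probability measures on $\mathcal X$. 1. For all integers $0<s<t$, $$J_t(\Phi,\Psi)=\inf_\Theta\big(J_s(\Phi,\Theta)+J_{t-s}(\Theta,\Psi)\big),$$ where $\Theta$ runs over all probability measures $\Theta\ll P_*$ on $\mathcal X$ that are reachable from $\Phi$ in time $s$ and from which $\Psi$ is reachable in time $t-s$. 2. In particular, the Bellman equation holds: for every $t>0$, $$J_{t+1}(\Phi,\Psi)=\inf_\Theta\big(J_1(\Phi,\Theta)+J_t(\Theta,\Psi)\big)=\inf_\Theta\big(J_t(\Phi,\Theta)+J_1(\Theta,\Psi)\big),$$ with the infima again over $\Theta\ll P_*$ for which both terms are finite. 3. Let $t>0$ and suppose that $J_t(\Phi,\Psi)<\infty$.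 Then every optimal noise, that is, every admissible noise with $P_0=\Phi$, $P_t=\Psi$ and $E_{0,t}=J_t(\Phi,\Psi)$, is Markov with respect to the state of the system on $[0,t)$: for every $0\le k<t$, almost surely $$\mathsf P_{W_k\mid Y_{0:k-1}}(\cdot\mid Y_{0:k-1})=\mathsf P_{W_k\mid X_k}(\cdot\mid X_k).$$ -/

import Mathlib

open MeasureTheory ProbabilityTheory
open scoped ENNReal

section StochasticSystem

/-- A sample point is a pair `ω = (x₀, w)`: the initial state and the whole noise sequence. -/
abbrev Sample (X W : Type*) : Type _ := X × (ℕ → W)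

/-- The state signal of the system `X_{k+1} = f (X_k, W_k)` started at `X_0 = x₀`. -/
def stateAt {X W : Type*} (f : X × W → X) : ℕ → Sample X W → X
  | 0, ω => ω.1
  | k + 1, ω => f (stateAt f k ω, ω.2 k)

/-- The block `W_{s:s+n-1} = (W_s, …, W_{s+n-1})` of `n` consecutive noise values. -/
def noiseBlock {X W : Type*} (s n : ℕ) (ω : Sample X W) : Fin n → W :=
  fun i => ω.2 (s + i)

/-- The state-noise sequence `Y_{0:k-1} = (X_0, W_0, …, W_{k-1})`. -/
def stateNoise {X W : Type*} (k : ℕ) (ω : Sample X W) : X × (Fin k → W) :=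
  (ω.1, noiseBlock 0 k ω)

variable {X W : Type*} [MeasurableSpace X] [MeasurableSpace W]

/-- The state distribution `P_k`, i.e. the law of `X_k` when `(X_0, W)` has the law `μ`. -/
noncomputable def stateLaw (f : X × W → X) (μ : Measure (Sample X W)) (k : ℕ) : Measure X :=
  μ.map (stateAt f k)

variable [StandardBorelSpace W] [Nonempty W]

/-- The conditional law of the noise `W_{s:t-1}` given the state `X_s`. -/
noncomputable def noiseGivenState (f : X × W → X) (μ : Measure (Sample X W)) [IsFiniteMeasure μ]
    (s t : ℕ) : Kernel X (Fin (t - s) → W) :=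
  condDistrib (noiseBlock s (t - s)) (stateAt f s) μ

/-- The nominal law `R^{t-s}` of the noise block `W_{s:t-1}`. -/
noncomputable def nominalNoise (R : Measure W) (s t : ℕ) : Measure (Fin (t - s) → W) :=
  Measure.pi fun _ => R

/-- The noise is admissible if, for all times `0 ≤ s < t`, the conditional law of `W_{s:t-1}` given
`X_s = x` is absolutely continuous with respect to `R^{t-s}` for `P_s`-almost all `x`. -/
def Admissible (f : X × W → X) (R : Measure W) (μ : Measure (Sample X W)) [IsFiniteMeasure μ] :
    Prop :=
  ∀ s t : ℕ, s < t →
    ∀ᵐ x ∂(stateLaw f μ s), noiseGivenState f μ s t x ≪ nominalNoise R s t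

/-- The conditional relative entropy supply `E_{s,t}`: the average over `x ∼ P_s` of the relative
entropy of the conditional law of `W_{s:t-1}` given `X_s = x` with respect to `R^{t-s}`. -/
noncomputable def supply (f : X × W → X) (R : Measure W) (μ : Measure (Sample X W))
    [IsFiniteMeasure μ] (s t : ℕ) : ℝ≥0∞ :=
  ∫⁻ x, InformationTheory.klDiv (noiseGivenState f μ s t x) (nominalNoise R s t) ∂(stateLaw f μ s)

/-- `μ` is the law of `(X_0, W)` for an admissible noise under which the state distribution evolves
from `P_0 = Φ` to `P_t = Ψ`. -/
structure Steers (f : X × W → X) (R : Measure W) (t : ℕ) (Φ Ψ : Measure X)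
    (μ : Measure (Sample X W)) [IsFiniteMeasure μ] : Prop where
  admissible : Admissible f R μ
  initial : stateLaw f μ 0 = Φ
  terminal : stateLaw f μ t = Ψ

/-- The minimum required supply `J_t(Φ, Ψ)`; it is `∞` if no admissible noise steers `Φ` to `Ψ`. -/
noncomputable def minSupply (f : X × W → X) (R : Measure W) (t : ℕ) (Φ Ψ : Measure X) : ℝ≥0∞ :=
  ⨅ (μ : Measure (Sample X W)) (_ : IsProbabilityMeasure μ) (_ : Steers f R t Φ Ψ μ),
    supply f R μ 0 t

/-- `Ψ` is reachable from `Φ` in time `t`, for state distributions absolutely continuous with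
respect to the nominal invariant state distribution `Pstar`. -/
structure Reachable (f : X × W → X) (R : Measure W) (Pstar : Measure X) (t : ℕ)
    (Φ Ψ : Measure X) : Prop where
  initial_ac : Φ ≪ Pstar
  terminal_ac : Ψ ≪ Pstar
  finite : minSupply f R t Φ Ψ < ∞

/-- The infimum of `J_s(Φ, Θ) + J_u(Θ, Ψ)` over all state distributions `Θ` that are reachable from
`Φ` in time `s` and from which `Ψ` is reachable in time `u`. -/
noncomputable def infOverIntermediate (f : X × W → X) (R : Measure W) (Pstar : Measure X)
    (s u : ℕ) (Φ Ψ : Measure X) : ℝ≥0∞ :=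
  ⨅ (Θ : Measure X) (_ : IsProbabilityMeasure Θ) (_ : Reachable f R Pstar s Φ Θ)
    (_ : Reachable f R Pstar u Θ Ψ), (minSupply f R s Φ Θ + minSupply f R u Θ Ψ)

/-- `μ` attains the (finite) minimum required supply. -/
structure IsOptimal (f : X × W → X) (R : Measure W) (t : ℕ) (Φ Ψ : Measure X)
    (μ : Measure (Sample X W)) [IsFiniteMeasure μ] : Prop where
  steers : Steers f R t Φ Ψ μ
  finite : minSupply f R t Φ Ψ < ∞
  attains : supply f R μ 0 t = minSupply f R t Φ Ψ

/-- The noise is Markov with respect to the state on the time interval `[0, t)`: for every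
`0 ≤ k < t`, almost surely, the conditional law of `W_k` given `Y_{0:k-1}` equals its conditional
law given `X_k`. -/
def IsMarkovNoise (f : X × W → X) (t : ℕ) (μ : Measure (Sample X W)) [IsFiniteMeasure μ] : Prop :=
  ∀ k < t, ∀ᵐ ω ∂μ,
    condDistrib (fun ω' : Sample X W => ω'.2 k) (stateNoise k) μ (stateNoise k ω) =
      condDistrib (fun ω' : Sample X W => ω'.2 k) (stateAt f k) μ (stateAt f k ω)

end StochasticSystem

/-! For an admissible noise the supply over `[0,t)` is a single divergence, that of the law of
`(X_0, W_{0:t-1})` from `P_0 × R^t` (`Admissible.supply_eq`). At an intermediate time `s` the chain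
rule `blockEntropy_add` splits it into the supply over `[0,s)` and the entropy of the later noise
conditioned on the whole past `Y_{0:s-1}`. Since `X_s` is a function of that past, data processing
bounds the second term below by `E_{s,t}` (`blockEntropy_le_pathEntropy`). Restarting the system at
`s` then gives the lower bound on `J_t`, with `Θ = P_s`; invariance of `Pstar` ensures `P_s ≪
Pstar`.

For the upper bound, `glueLaw` runs one noise up to time `s` and then draws a second one given `X_s`
alone. The later noise is conditionally independent of the past given `X_s`, so data processing
loses nothing and the supplies add (`blockEntropy_glueLaw`).

For the Markov property, an optimal noise is compared with the noise obtained by gluing it to its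
own restart at time `k`. Both steer `Φ` to `Ψ`, and their supplies differ exactly by the data
processing gap. Optimality makes this gap vanish, and the equality case
`eq_compProd_comap_of_klDiv_le` gives conditional independence. -/

/-! ### Divergence of joint laws. -/

section KullbackLeibler

open InformationTheory

variable {α β : Type*} [MeasurableSpace α] [MeasurableSpace β]

/-- The Kullback–Leibler divergence is invariant under maps with a measurable left inverse. -/
theorem klDiv_map_of_leftInverse {μ ν : Measure α} [IsFiniteMeasure μ] [IsFiniteMeasure ν]
    {g : α → β} {h : β → α} (hg : Measurable g) (hh : Measurable h)
    (hgh : Function.LeftInverse h g) :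
    klDiv (μ.map g) (ν.map g) = klDiv μ ν := by
  refine le_antisymm (klDiv_map_le μ ν hg) ?_
  have key : ∀ ρ : Measure α, (ρ.map g).map h = ρ := fun ρ => by
    rw [Measure.map_map hh hg, hgh.comp_eq_id, Measure.map_id]
  calc klDiv μ ν = klDiv ((μ.map g).map h) ((ν.map g).map h) := by rw [key, key]
    _ ≤ _ := klDiv_map_le _ _ hh

/-- The conditional relative entropy as an average of relative entropies. -/
theorem klDiv_compProd_right_eq_lintegral {μ : Measure α} [IsFiniteMeasure μ]
    {κ η : Kernel α β} [IsFiniteKernel κ] [IsFiniteKernel η]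
    [MeasurableSpace.CountableOrCountablyGenerated α β] (h : ∀ᵐ x ∂μ, κ x ≪ η x) :
    klDiv (μ ⊗ₘ κ) (μ ⊗ₘ η) = ∫⁻ x, klDiv (κ x) (η x) ∂μ := by
  have hac : μ ⊗ₘ κ ≪ μ ⊗ₘ η := Measure.absolutelyContinuous_compProd_right_iff.2 h
  -- The kernel derivative is jointly measurable, as integrating fibrewise requires; for each `x` it
  -- agrees almost everywhere with the derivative of `κ x`.
  have hdens : (μ ⊗ₘ κ).rnDeriv (μ ⊗ₘ η) =ᵐ[μ ⊗ₘ η] fun p => κ.rnDeriv η p.1 p.2 := by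
    have hm : Measurable fun p : α × β => κ.rnDeriv η p.1 p.2 := κ.measurable_rnDeriv η
    have heq : μ ⊗ₘ κ = (μ ⊗ₘ η).withDensity (fun p => κ.rnDeriv η p.1 p.2) := by
      rw [← Measure.compProd_withDensity (κ.measurable_rnDeriv η)]
      refine Measure.compProd_congr ?_
      filter_upwards [h] with x hx using (Kernel.withDensity_rnDeriv_eq hx).symm
    rw [heq]
    exact Measure.rnDeriv_withDensity _ hm
  have hmk : Measurable fun p : α × β => ENNReal.ofReal (klFun (κ.rnDeriv η p.1 p.2).toReal) :=
    (measurable_klFun.comp (κ.measurable_rnDeriv η).ennreal_toReal).ennreal_ofReal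
  rw [klDiv_eq_lintegral_klFun_of_ac hac,
    lintegral_congr_ae (g := fun p => ENNReal.ofReal (klFun (κ.rnDeriv η p.1 p.2).toReal))
      (by filter_upwards [hdens] with p hp; rw [hp]),
    Measure.lintegral_compProd hmk]
  refine lintegral_congr_ae ?_
  filter_upwards [h] with x hx
  rw [klDiv_eq_lintegral_klFun_of_ac hx]
  refine lintegral_congr_ae ?_
  filter_upwards [Kernel.rnDeriv_eq_rnDeriv_measure (κ := κ) (η := η) (a := x)] with w hw
  rw [hw]

end KullbackLeibler

/-! ### Data processing under `y ↦ F y` and its equality case. -/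

section ConditionalIndependence

open InformationTheory

variable {α β γ : Type*} [MeasurableSpace α] [MeasurableSpace β] [MeasurableSpace γ]
  [StandardBorelSpace β] [Nonempty β]

/-- If `y ∼ ρ` and `w` is drawn from `κ (F y)`, then `y` depends on `(F y, w)` only through
`F y`. -/
theorem map_compProd_comap_eq_compProd_condDistrib {ρ : Measure β} [IsFiniteMeasure ρ]
    {F : β → α} (hF : Measurable F) (κ : Kernel α γ) [IsMarkovKernel κ] :
    (ρ ⊗ₘ κ.comap F hF).map (fun p => ((F p.1, p.2), p.1)) =
      (ρ.map F ⊗ₘ κ) ⊗ₘ (condDistrib id F ρ).prodMkRight γ := by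
  have hmap : ρ.map F ⊗ₘ condDistrib id F ρ = ρ.map fun y => (F y, y) :=
    compProd_map_condDistrib aemeasurable_id
  refine Measure.ext_of_lintegral _ fun g hg => ?_
  have hm : Measurable fun q : α × β => ∫⁻ w, g ((q.1, w), q.2) ∂(κ q.1) := by
    have := Measurable.lintegral_kernel_prod_right'
      (κ := κ.comap (Prod.fst : α × β → α) measurable_fst)
      (f := fun p : (α × β) × γ => g ((p.1.1, p.2), p.1.2)) (by fun_prop)
    simpa using this
  rw [lintegral_map hg (by fun_prop), Measure.lintegral_compProd (by fun_prop),
    Measure.lintegral_compProd hg, Measure.lintegral_compProd]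
  · calc ∫⁻ y, ∫⁻ w, g ((F y, w), y) ∂(κ.comap F hF y) ∂ρ
        = ∫⁻ q, ∫⁻ w, g ((q.1, w), q.2) ∂(κ q.1) ∂(ρ.map fun y => (F y, y)) := by
          rw [lintegral_map hm (by fun_prop)]
          simp [Kernel.comap_apply]
      _ = ∫⁻ x, ∫⁻ y, ∫⁻ w, g ((x, w), y) ∂(κ x) ∂(condDistrib id F ρ x) ∂(ρ.map F) := by
          rw [← hmap, Measure.lintegral_compProd hm]
      _ = _ := by
          refine lintegral_congr fun x => ?_
          -- Given `x = F y`, the variables `y` and `w` are independent.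
          rw [lintegral_lintegral_swap]
          · simp [Kernel.prodMkRight_apply]
          · exact (hg.comp (by fun_prop : Measurable fun p : β × γ => ((x, p.2), p.1))).aemeasurable
  · exact hg.lintegral_kernel_prod_right'

/-- Conditioning on more than what the kernels use does not change the conditional relative
entropy. -/
theorem klDiv_compProd_comap {ρ : Measure β} [IsFiniteMeasure ρ]
    {F : β → α} (hF : Measurable F) (κ η : Kernel α γ) [IsMarkovKernel κ] [IsMarkovKernel η] :
    klDiv (ρ ⊗ₘ κ.comap F hF) (ρ ⊗ₘ η.comap F hF) = klDiv (ρ.map F ⊗ₘ κ) (ρ.map F ⊗ₘ η) := by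
  -- After this injective reordering both measures have the same kernel from `(F y, w)` to `y`,
  -- which cancels.
  rw [← klDiv_map_of_leftInverse (g := fun p : β × γ => ((F p.1, p.2), p.1))
      (h := fun q => (q.2, q.1.2)) (by fun_prop) (by fun_prop) (fun _ => rfl),
    map_compProd_comap_eq_compProd_condDistrib hF, map_compProd_comap_eq_compProd_condDistrib hF,
    klDiv_compProd_left]

/-- The equality case of the data processing inequality for conditional relative entropies: if
replacing the condition `y` by `F y` does not decrease the (finite) relative entropy of `w`, then
`w` depends on `y` only through `F y`. -/
theorem eq_compProd_comap_of_klDiv_le {ρ : Measure β} [IsFiniteMeasure ρ]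
    {F : β → α} (hF : Measurable F) {r : Measure γ} [IsProbabilityMeasure r]
    {P : Measure (β × γ)} [IsFiniteMeasure P]
    {κ : Kernel α γ} [IsMarkovKernel κ] (hκ : P.map (fun p => (F p.1, p.2)) = ρ.map F ⊗ₘ κ)
    (hfin : klDiv P (ρ.prod r) ≠ ∞)
    (hle : klDiv P (ρ.prod r) ≤ klDiv (P.map fun p => (F p.1, p.2)) ((ρ.map F).prod r)) :
    P = ρ ⊗ₘ κ.comap F hF := by
  -- `G` is injective, so it preserves divergence, and it puts `(F y, w)` first: the chain rule then
  -- isolates the loss, which compares the laws of `y` given `(F y, w)` under `P` (`τ`) and under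
  -- the reference (`π`, blind to `w`).
  set G : β × γ → (α × γ) × β := fun p => ((F p.1, p.2), p.1) with hG
  have hGm : Measurable G := by fun_prop
  set Q := P.map (fun p => (F p.1, p.2)) with hQ
  set π := (condDistrib id F ρ).prodMkRight γ with hπ
  set τ := condDistrib Prod.fst (fun p : β × γ => (F p.1, p.2)) P with hτ
  have hPG : P.map G = Q ⊗ₘ τ := (compProd_map_condDistrib (by fun_prop)).symm
  have href : (ρ.prod r).map G = ((ρ.map F).prod r) ⊗ₘ π := by
    have := map_compProd_comap_eq_compProd_condDistrib (ρ := ρ) hF (Kernel.const α r)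
    have hc : (Kernel.const α r).comap F hF = Kernel.const β r := rfl
    rwa [hc, Measure.compProd_const, Measure.compProd_const] at this
  have hsum : klDiv P (ρ.prod r) = klDiv Q ((ρ.map F).prod r) + klDiv (Q ⊗ₘ τ) (Q ⊗ₘ π) := by
    rw [← klDiv_map_of_leftInverse (g := G) (h := fun q => (q.2, q.1.2)) hGm (by fun_prop)
      (fun _ => rfl), hPG, href, klDiv_compProd_eq_add]
  have hQfin : klDiv Q ((ρ.map F).prod r) ≠ ∞ := by
    intro h; rw [hsum, h, top_add] at hfin; exact hfin rfl
  have hzero : klDiv (Q ⊗ₘ τ) (Q ⊗ₘ π) = 0 := by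
    rw [hsum] at hle
    have : klDiv Q ((ρ.map F).prod r) + klDiv (Q ⊗ₘ τ) (Q ⊗ₘ π) ≤
      klDiv Q ((ρ.map F).prod r) + 0 := by simpa using hle
    simpa using (ENNReal.add_le_add_iff_left hQfin).1 this
  have heq : P.map G = (ρ ⊗ₘ κ.comap F hF).map G := by
    rw [hPG, klDiv_eq_zero_iff.1 hzero, hκ, map_compProd_comap_eq_compProd_condDistrib hF]
  have hinv : ∀ m : Measure (β × γ), (m.map G).map (fun q => (q.2, q.1.2)) = m := fun m => by
    rw [Measure.map_map (by fun_prop) hGm]; exact Measure.map_id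
  rw [← hinv P, heq, hinv]

end ConditionalIndependence

/-! ### Splitting product measures. -/

section Blocks

variable {β : Type*} [MeasurableSpace β]

/-- The product measure on `m + n` factors is the product of those on `m` and on `n` factors. -/
theorem map_pi_split (R : Measure β) [SigmaFinite R] (m n : ℕ) :
    (Measure.pi fun _ : Fin (m + n) => R).map
        (fun w => ((fun i => w (Fin.castAdd n i), fun j => w (Fin.natAdd m j)) :
          (Fin m → β) × (Fin n → β))) =
      (Measure.pi fun _ : Fin m => R).prod (Measure.pi fun _ : Fin n => R) := by
  have happ : Measurable fun p : (Fin m → β) × (Fin n → β) => Fin.append p.1 p.2 := by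
    refine measurable_pi_iff.2 fun i => ?_
    refine Fin.addCases (fun i => ?_) (fun j => ?_) i
    · simp only [Fin.append_left]; fun_prop
    · simp only [Fin.append_right]; fun_prop
  have key : (Measure.pi fun _ : Fin (m + n) => R) =
      ((Measure.pi fun _ : Fin m => R).prod (Measure.pi fun _ : Fin n => R)).map
        fun p => Fin.append p.1 p.2 := by
    refine Measure.pi_eq fun s hs => ?_
    have hpre : (fun p : (Fin m → β) × (Fin n → β) => Fin.append p.1 p.2) ⁻¹' Set.univ.pi s =
        (Set.univ.pi fun i => s (Fin.castAdd n i)) ×ˢ (Set.univ.pi fun j => s (Fin.natAdd m j)) := by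
      ext p
      simp only [Set.mem_preimage, Set.mem_pi, Set.mem_univ, forall_true_left, Set.mem_prod]
      refine ⟨fun h => ⟨fun i => by simpa using h (Fin.castAdd n i),
        fun j => by simpa using h (Fin.natAdd m j)⟩, fun h i => ?_⟩
      refine Fin.addCases (fun i => ?_) (fun j => ?_) i
      · simpa using h.1 i
      · simpa using h.2 j
    rw [Measure.map_apply happ (MeasurableSet.univ_pi hs), hpre, Measure.prod_prod,
      Measure.pi_pi, Measure.pi_pi, Fin.prod_univ_add]
  rw [key, Measure.map_map (by fun_prop) happ]
  convert Measure.map_id using 2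
  funext p
  simp

end Blocks

/-! ### Laws of states and noise blocks, and their entropies. -/

section SystemLaws

open InformationTheory

variable {X W : Type*}

/-- The state `X_k` as a function of `Y_{0:k-1} = (X_0, W_0, …, W_{k-1})`. -/
def blockState (f : X × W → X) : (k : ℕ) → X × (Fin k → W) → X
  | 0, p => p.1
  | k + 1, p => f (blockState f k (p.1, fun i => p.2 i.castSucc), p.2 (Fin.last k))

theorem blockState_stateNoise (f : X × W → X) (k : ℕ) (ω : Sample X W) :
    blockState f k (stateNoise k ω) = stateAt f k ω := by
  induction k with
  | zero => rfl
  | succ k ih =>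
    rw [stateAt, ← ih]
    have h : noiseBlock 0 k ω = fun i : Fin k => noiseBlock 0 (k + 1) ω i.castSucc := rfl
    simp [blockState, stateNoise, h, noiseBlock]

/-- Splitting `(X_0, W_{0:s+n-1})` into `(Y_{0:s-1}, W_{s:s+n-1})`. -/
def splitBlock (s n : ℕ) (p : X × (Fin (s + n) → W)) : (X × (Fin s → W)) × (Fin n → W) :=
  ((p.1, fun i => p.2 (Fin.castAdd n i)), fun j => p.2 (Fin.natAdd s j))

theorem leftInverse_splitBlock (s n : ℕ) :
    Function.LeftInverse (fun q : (X × (Fin s → W)) × (Fin n → W) =>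
      (q.1.1, Fin.append q.1.2 q.2)) (splitBlock s n) := by
  rintro ⟨x, w⟩
  refine Prod.ext rfl (funext fun i => ?_)
  refine Fin.addCases (fun i => ?_) (fun j => ?_) i <;> simp [splitBlock]

variable [MeasurableSpace X] [MeasurableSpace W]

theorem measurable_blockState {f : X × W → X} (hf : Measurable f) (k : ℕ) :
    Measurable (blockState f k) := by
  induction k with
  | zero => exact measurable_fst
  | succ k ih =>
    exact hf.comp ((ih.comp (by fun_prop)).prodMk (by fun_prop))

theorem measurable_stateAt {f : X × W → X} (hf : Measurable f) (k : ℕ) :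
    Measurable (stateAt f k) := by
  induction k with
  | zero => exact measurable_fst
  | succ k ih => exact hf.comp (ih.prodMk (by fun_prop))

@[fun_prop]
theorem measurable_noiseBlock (s n : ℕ) :
    Measurable (noiseBlock s n : Sample X W → Fin n → W) := by
  unfold noiseBlock; fun_prop

@[fun_prop]
theorem measurable_stateNoise (k : ℕ) :
    Measurable (stateNoise k : Sample X W → X × (Fin k → W)) := by
  unfold stateNoise; fun_prop

/-- The joint law of the state `X_s` and the noise block `W_{s:s+n-1}`. -/
noncomputable def blockLaw (f : X × W → X) (μ : Measure (Sample X W)) (s n : ℕ) :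
    Measure (X × (Fin n → W)) :=
  μ.map fun ω => (stateAt f s ω, noiseBlock s n ω)

/-- The joint law of `Y_{0:s-1}` and the noise block `W_{s:s+n-1}`. -/
noncomputable def pathLaw (μ : Measure (Sample X W)) (s n : ℕ) :
    Measure ((X × (Fin s → W)) × (Fin n → W)) :=
  μ.map fun ω => (stateNoise s ω, noiseBlock s n ω)

/-- The relative entropy of the law of `(X_s, W_{s:s+n-1})` with respect to `P_s × R^n`. -/
noncomputable def blockEntropy (f : X × W → X) (R : Measure W) (μ : Measure (Sample X W))
    (s n : ℕ) : ℝ≥0∞ :=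
  klDiv (blockLaw f μ s n) ((stateLaw f μ s).prod (Measure.pi fun _ : Fin n => R))

/-- The relative entropy of the law of `(Y_{0:s-1}, W_{s:s+n-1})` with respect to the product of the
law of `Y_{0:s-1}` and `R^n`. -/
noncomputable def pathEntropy (R : Measure W) (μ : Measure (Sample X W)) (s n : ℕ) : ℝ≥0∞ :=
  klDiv (pathLaw μ s n) ((μ.map (stateNoise s)).prod (Measure.pi fun _ : Fin n => R))

variable {f : X × W → X} {R : Measure W} {μ : Measure (Sample X W)}

instance [IsFiniteMeasure μ] (s n : ℕ) : IsFiniteMeasure (blockLaw f μ s n) := by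
  unfold blockLaw; infer_instance

instance [IsFiniteMeasure μ] (s n : ℕ) : IsFiniteMeasure (pathLaw μ s n) := by
  unfold pathLaw; infer_instance

instance [IsFiniteMeasure μ] (s : ℕ) : IsFiniteMeasure (stateLaw f μ s) := by
  unfold stateLaw; infer_instance

theorem isProbabilityMeasure_stateLaw (hf : Measurable f) [IsProbabilityMeasure μ] (s : ℕ) :
    IsProbabilityMeasure (stateLaw f μ s) :=
  Measure.isProbabilityMeasure_map (measurable_stateAt hf s).aemeasurable

theorem stateLaw_zero : stateLaw f μ 0 = μ.map Prod.fst := rfl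

theorem map_blockState_stateNoise (hf : Measurable f) (s : ℕ) :
    (μ.map (stateNoise s)).map (blockState f s) = stateLaw f μ s := by
  rw [Measure.map_map (measurable_blockState hf s) (by fun_prop)]
  exact congrArg (fun g => μ.map g) (funext fun ω => blockState_stateNoise f s ω)

theorem map_blockState_pathLaw (hf : Measurable f) (s n : ℕ) :
    (pathLaw μ s n).map (fun p => (blockState f s p.1, p.2)) = blockLaw f μ s n := by
  have hb := measurable_blockState hf s
  rw [pathLaw, Measure.map_map (by fun_prop) (by fun_prop)]
  exact congrArg (fun g => μ.map g)
    (funext fun ω => Prod.ext (blockState_stateNoise f s ω) rfl)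

@[fun_prop]
theorem measurable_splitBlock (s n : ℕ) : Measurable (splitBlock s n : X × (Fin (s + n) → W) → _) := by
  unfold splitBlock; fun_prop

theorem map_splitBlock_blockLaw (s n : ℕ) :
    (blockLaw f μ 0 (s + n)).map (splitBlock s n) = pathLaw μ s n := by
  have h0 : Measurable (stateAt f 0 : Sample X W → X) := measurable_fst
  rw [blockLaw, Measure.map_map (by fun_prop) (by fun_prop), pathLaw]
  congr 1
  funext ω
  refine Prod.ext (Prod.ext rfl (funext fun i => ?_)) (funext fun j => ?_) <;>
    simp [splitBlock, stateNoise, noiseBlock]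

theorem map_splitBlock_prod (ρ : Measure X) [SFinite ρ] [SigmaFinite R] (s n : ℕ) :
    (ρ.prod (Measure.pi fun _ : Fin (s + n) => R)).map (splitBlock s n) =
      (ρ.prod (Measure.pi fun _ : Fin s => R)).prod (Measure.pi fun _ : Fin n => R) := by
  have hmap : Measurable fun w : Fin (s + n) → W =>
      ((fun i => w (Fin.castAdd n i), fun j => w (Fin.natAdd s j)) :
        (Fin s → W) × (Fin n → W)) := by fun_prop
  have h1 := Measure.map_prod_map ρ (Measure.pi fun _ : Fin (s + n) => R) measurable_id hmap
  rw [map_pi_split, Measure.map_id, ← Measure.prodAssoc_prod] at h1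
  have h2 := congrArg (fun m => m.map MeasurableEquiv.prodAssoc.symm) h1
  simp only at h2
  rw [Measure.map_map (by fun_prop) (by fun_prop), MeasurableEquiv.symm_comp_self, Measure.map_id,
    Measure.map_map (by fun_prop) (by fun_prop)] at h2
  exact h2.symm

theorem measurable_append (s n : ℕ) :
    Measurable fun q : (X × (Fin s → W)) × (Fin n → W) => (q.1.1, Fin.append q.1.2 q.2) := by
  refine measurable_fst.fst.prodMk (measurable_pi_iff.2 fun i => ?_)
  refine Fin.addCases (fun i => ?_) (fun j => ?_) i
  · simp only [Fin.append_left]; fun_prop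
  · simp only [Fin.append_right]; fun_prop

/-- The entropy chain rule for the noise before and after time `s`. -/
theorem blockEntropy_add [StandardBorelSpace W] [Nonempty W] [IsFiniteMeasure μ]
    [IsProbabilityMeasure R] (s n : ℕ) :
    blockEntropy f R μ 0 (s + n) = blockEntropy f R μ 0 s + pathEntropy R μ s n := by
  have hpath : pathLaw μ s n =
      μ.map (stateNoise s) ⊗ₘ condDistrib (noiseBlock s n) (stateNoise s) μ :=
    (compProd_map_condDistrib (by fun_prop)).symm
  rw [blockEntropy, ← klDiv_map_of_leftInverse (measurable_splitBlock s n) (measurable_append s n)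
    (leftInverse_splitBlock s n), map_splitBlock_blockLaw, map_splitBlock_prod, hpath,
    ← Measure.compProd_const, klDiv_compProd_eq_add, pathEntropy, hpath, Measure.compProd_const]
  -- `Y_{0:s-1}` is `(X_0, W_{0:s-1})`, so its law is `blockLaw f μ 0 s` by definition.
  rfl

/-- Conditioning the noise on the state only, instead of the whole past, decreases the entropy. -/
theorem blockEntropy_le_pathEntropy (hf : Measurable f) [IsFiniteMeasure μ]
    [IsProbabilityMeasure R] (s n : ℕ) :
    blockEntropy f R μ s n ≤ pathEntropy R μ s n := by
  have hb := measurable_blockState hf s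
  have href : ((μ.map (stateNoise s)).prod (Measure.pi fun _ : Fin n => R)).map
      (fun p => (blockState f s p.1, p.2)) =
        (stateLaw f μ s).prod (Measure.pi fun _ : Fin n => R) := by
    rw [← map_blockState_stateNoise hf s]
    have := Measure.map_prod_map (μ.map (stateNoise s)) (Measure.pi fun _ : Fin n => R) hb
      measurable_id
    rw [Measure.map_id] at this
    exact this.symm
  rw [blockEntropy, ← map_blockState_pathLaw hf, ← href]
  exact klDiv_map_le _ _ (by fun_prop)

/-- Discarding the last noise values is a pushforward, and it sends the reference product to the
shorter one. -/
theorem blockLaw_absolutelyContinuous_of_le [IsProbabilityMeasure R] [IsFiniteMeasure μ]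
    (hf : Measurable f) {s m n : ℕ} (hmn : m ≤ n)
    (h : blockLaw f μ s n ≪ (stateLaw f μ s).prod (Measure.pi fun _ : Fin n => R)) :
    blockLaw f μ s m ≪ (stateLaw f μ s).prod (Measure.pi fun _ : Fin m => R) := by
  obtain ⟨k, rfl⟩ := Nat.exists_eq_add_of_le hmn
  have hs := measurable_stateAt hf s
  have hg : Measurable fun p : X × (Fin (m + k) → W) => (splitBlock m k p).1 := by fun_prop
  have h1 := h.map hg
  have h2 : ((stateLaw f μ s).prod (Measure.pi fun _ : Fin (m + k) => R)).map
      (fun p => (splitBlock m k p).1) = (stateLaw f μ s).prod (Measure.pi fun _ : Fin m => R) := by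
    have := congrArg Measure.fst (map_splitBlock_prod (R := R) (stateLaw f μ s) m k)
    rwa [Measure.fst_prod, Measure.fst, Measure.map_map (by fun_prop) (by fun_prop)] at this
  rw [h2, blockLaw, Measure.map_map hg (by fun_prop)] at h1
  exact h1

/-! ### Admissibility as absolute continuity of joint laws. -/

section Admissibility

variable [StandardBorelSpace W] [Nonempty W]

theorem blockLaw_eq_compProd [IsFiniteMeasure μ] (s n : ℕ) :
    blockLaw f μ s n = stateLaw f μ s ⊗ₘ condDistrib (noiseBlock s n) (stateAt f s) μ :=
  (compProd_map_condDistrib (by fun_prop)).symm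

theorem blockLaw_absolutelyContinuous_iff [IsFiniteMeasure μ] [IsProbabilityMeasure R] (s n : ℕ) :
    blockLaw f μ s n ≪ (stateLaw f μ s).prod (Measure.pi fun _ : Fin n => R) ↔
      ∀ᵐ x ∂(stateLaw f μ s), condDistrib (noiseBlock s n) (stateAt f s) μ x ≪
        Measure.pi fun _ : Fin n => R := by
  rw [blockLaw_eq_compProd, ← Measure.compProd_const,
    Measure.absolutelyContinuous_compProd_right_iff]
  rfl

theorem Admissible.blockLaw_absolutelyContinuous [IsProbabilityMeasure R] [IsFiniteMeasure μ]
    (hf : Measurable f) (h : Admissible f R μ) (s n : ℕ) :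
    blockLaw f μ s n ≪ (stateLaw f μ s).prod (Measure.pi fun _ : Fin n => R) := by
  -- Admissibility only concerns nonempty blocks; passing through length `n + 1` also covers `n =
  -- 0`.
  refine blockLaw_absolutelyContinuous_of_le hf (Nat.le_succ n) ?_
  have := h s (s + (n + 1)) (by omega)
  rw [noiseGivenState, nominalNoise, ← blockLaw_absolutelyContinuous_iff] at this
  rwa [Nat.add_sub_cancel_left] at this

/-- A noise is admissible once its law given the initial state has densities. -/
theorem admissible_of_blockLaw_zero [IsProbabilityMeasure R] [IsFiniteMeasure μ]
    (hf : Measurable f)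
    (h : ∀ n, blockLaw f μ 0 n ≪ (stateLaw f μ 0).prod (Measure.pi fun _ : Fin n => R)) :
    Admissible f R μ := by
  intro s t _
  rw [noiseGivenState, nominalNoise, ← blockLaw_absolutelyContinuous_iff]
  generalize t - s = n
  have hb := measurable_blockState hf s
  have h1 := ((h (s + n)).map (measurable_splitBlock s n)).map
    (f := fun p => (blockState f s p.1, p.2)) (by fun_prop)
  rw [map_splitBlock_blockLaw, map_splitBlock_prod, map_blockState_pathLaw hf] at h1
  have h2 := Measure.map_prod_map ((stateLaw f μ 0).prod (Measure.pi fun _ : Fin s => R))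
    (Measure.pi fun _ : Fin n => R) hb measurable_id
  rw [Measure.map_id] at h2
  have h3 : blockLaw f μ s n ≪ (((stateLaw f μ 0).prod (Measure.pi fun _ : Fin s => R)).map
    (blockState f s)).prod (Measure.pi fun _ : Fin n => R) := by
    rw [h2]; exact h1
  rw [blockLaw_eq_compProd, ← Measure.compProd_const] at h3 ⊢
  -- In `h3` the reference state law is the one produced by nominal noise up to time `s`; it may be
  -- replaced by `P_s` itself.
  exact Measure.absolutelyContinuous_compProd_of_compProd h3

/-- Admissibility is what lets the averaged divergence be read as one divergence of joint laws, to
which the chain rule and data processing apply. -/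
theorem Admissible.supply_eq [IsProbabilityMeasure R] [IsFiniteMeasure μ]
    (h : Admissible f R μ) {s t : ℕ} (hst : s < t) :
    supply f R μ s t = blockEntropy f R μ s (t - s) := by
  rw [blockEntropy, blockLaw_eq_compProd, ← Measure.compProd_const,
    klDiv_compProd_right_eq_lintegral (h s t hst)]
  rfl

/-- Admissible noises preserve absolute continuity with respect to the nominal invariant law. -/
theorem Admissible.stateLaw_absolutelyContinuous [IsProbabilityMeasure R] [IsFiniteMeasure μ]
    (hf : Measurable f) {Pstar : Measure X} [IsProbabilityMeasure Pstar]
    (hinv : (Pstar.prod R).map f = Pstar) (h : Admissible f R μ)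
    (h0 : stateLaw f μ 0 ≪ Pstar) (k : ℕ) : stateLaw f μ k ≪ Pstar := by
  induction k with
  | zero => exact h0
  | succ k ih =>
    have hs := measurable_stateAt hf k
    -- The law of `(X_k, W_k)` is dominated by `Pstar × R`, whose image under `f` is `Pstar`.
    have h1 := (h.blockLaw_absolutelyContinuous hf k 1).trans
      (ih.prod (Measure.AbsolutelyContinuous.refl (Measure.pi fun _ : Fin 1 => R)))
    have h2 := h1.map (f := fun p => f (p.1, p.2 0)) (by fun_prop)
    have h3 : (Pstar.prod (Measure.pi fun _ : Fin 1 => R)).map (fun p => f (p.1, p.2 0)) =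
        Pstar := by
      have := Measure.map_prod_map Pstar (Measure.pi fun _ : Fin 1 => R) measurable_id
        (measurable_pi_apply 0)
      rw [Measure.map_id, (measurePreserving_eval (fun _ : Fin 1 => R) 0).map_eq] at this
      conv_rhs => rw [← hinv, this, Measure.map_map hf (by fun_prop)]
      rfl
    rw [h3, blockLaw, Measure.map_map (by fun_prop) (by fun_prop)] at h2
    exact h2

end Admissibility

end SystemLaws

/-! ### Restarting the system and gluing two noises. -/

section ShiftAndGlue

open InformationTheory

variable {X W : Type*}

/-- The system restarted at time `s`. -/
def shiftSample (f : X × W → X) (s : ℕ) (ω : Sample X W) : Sample X W :=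
  (stateAt f s ω, fun i => ω.2 (s + i))

theorem stateAt_shiftSample (f : X × W → X) (s k : ℕ) (ω : Sample X W) :
    stateAt f k (shiftSample f s ω) = stateAt f (s + k) ω := by
  induction k with
  | zero => rfl
  | succ k ih => rw [stateAt, ih]; rfl

theorem noiseBlock_shiftSample (f : X × W → X) (s n : ℕ) (ω : Sample X W) :
    noiseBlock 0 n (shiftSample f s ω) = noiseBlock s n ω := by
  funext i
  simp [noiseBlock, shiftSample]

/-- Replace the noise from time `s` on. -/
def replaceTail (s : ℕ) (p : Sample X W × (ℕ → W)) : Sample X W :=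
  (p.1.1, fun i => if i < s then p.1.2 i else p.2 (i - s))

theorem stateNoise_replaceTail (s : ℕ) (p : Sample X W × (ℕ → W)) :
    stateNoise s (replaceTail s p) = stateNoise s p.1 := by
  refine Prod.ext rfl (funext fun i => ?_)
  simp [stateNoise, noiseBlock, replaceTail]

theorem noiseBlock_replaceTail (s n : ℕ) (p : Sample X W × (ℕ → W)) :
    noiseBlock s n (replaceTail s p) = fun i : Fin n => p.2 i := by
  funext i
  simp [noiseBlock, replaceTail]

theorem shiftSample_replaceTail (f : X × W → X) (s : ℕ) (p : Sample X W × (ℕ → W)) :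
    shiftSample f s (replaceTail s p) = (stateAt f s p.1, p.2) := by
  refine Prod.ext ?_ (funext fun i => ?_)
  · simp only [shiftSample]
    rw [← blockState_stateNoise, stateNoise_replaceTail, blockState_stateNoise]
  · simp [shiftSample, replaceTail]

variable [MeasurableSpace X] [MeasurableSpace W] {f : X × W → X} {R : Measure W}
  {μ μ' : Measure (Sample X W)}

theorem measurable_shiftSample (hf : Measurable f) (s : ℕ) : Measurable (shiftSample f s) :=
  (measurable_stateAt hf s).prodMk (by fun_prop)

@[fun_prop]
theorem measurable_replaceTail (s : ℕ) :
    Measurable (replaceTail s : Sample X W × (ℕ → W) → Sample X W) := by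
  refine measurable_fst.fst.prodMk (measurable_pi_iff.2 fun i => ?_)
  by_cases h : i < s <;> simp only [h, if_true, if_false] <;> fun_prop

theorem stateLaw_map_shiftSample (hf : Measurable f) (s k : ℕ) :
    stateLaw f (μ.map (shiftSample f s)) k = stateLaw f μ (s + k) := by
  rw [stateLaw, Measure.map_map (measurable_stateAt hf k) (measurable_shiftSample hf s)]
  exact congrArg (fun g => μ.map g) (funext fun ω => stateAt_shiftSample f s k ω)

theorem blockLaw_map_shiftSample (hf : Measurable f) (s n : ℕ) :
    blockLaw f (μ.map (shiftSample f s)) 0 n = blockLaw f μ s n := by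
  have h0 := measurable_stateAt hf 0
  rw [blockLaw, Measure.map_map (by fun_prop) (measurable_shiftSample hf s)]
  exact congrArg (fun g => μ.map g) (funext fun ω =>
    Prod.ext rfl (noiseBlock_shiftSample f s n ω))

theorem blockEntropy_map_shiftSample (hf : Measurable f) (s n : ℕ) :
    blockEntropy f R (μ.map (shiftSample f s)) 0 n = blockEntropy f R μ s n := by
  rw [blockEntropy, blockLaw_map_shiftSample hf, stateLaw_map_shiftSample hf, blockEntropy]
  rfl

theorem map_prodMap_compProd_comap {α β γ δ : Type*} [MeasurableSpace α] [MeasurableSpace β]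
    [MeasurableSpace γ] [MeasurableSpace δ] {ρ : Measure α} [SFinite ρ] {g : α → β}
    (hg : Measurable g)
    {F : β → γ} (hF : Measurable F) (κ : Kernel γ δ) [IsSFiniteKernel κ] :
    (ρ ⊗ₘ κ.comap (F ∘ g) (hF.comp hg)).map (fun p => (g p.1, p.2)) =
      ρ.map g ⊗ₘ κ.comap F hF := by
  refine Measure.ext_of_lintegral _ fun φ hφ => ?_
  rw [lintegral_map hφ (by fun_prop), Measure.lintegral_compProd (by fun_prop),
    Measure.lintegral_compProd hφ, lintegral_map hφ.lintegral_kernel_prod_right' hg]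
  rfl

section Glue

variable [StandardBorelSpace W] [Nonempty W]

theorem Admissible.map_shiftSample [IsProbabilityMeasure R] [IsFiniteMeasure μ]
    (hf : Measurable f) (h : Admissible f R μ) (s : ℕ) :
    Admissible f R (μ.map (shiftSample f s)) := by
  refine admissible_of_blockLaw_zero hf fun n => ?_
  rw [blockLaw_map_shiftSample hf, stateLaw_map_shiftSample hf]
  exact h.blockLaw_absolutelyContinuous hf s n

/-- The noise that follows the law `μ` up to time `s`, and from then on is drawn according to the
law `μ'` given the state `X_s`. -/
noncomputable def glueLaw (hf : Measurable f) (s : ℕ) (μ μ' : Measure (Sample X W))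
    [IsFiniteMeasure μ'] : Measure (Sample X W) :=
  (μ ⊗ₘ (condDistrib Prod.snd Prod.fst μ').comap (stateAt f s) (measurable_stateAt hf s)).map
    (replaceTail s)

instance (hf : Measurable f) (s : ℕ) [IsProbabilityMeasure μ] [IsFiniteMeasure μ'] :
    IsProbabilityMeasure (glueLaw hf s μ μ') := by
  unfold glueLaw
  exact Measure.isProbabilityMeasure_map (by fun_prop)

theorem map_stateNoise_glueLaw (hf : Measurable f) (s : ℕ) [IsFiniteMeasure μ]
    [IsFiniteMeasure μ'] :
    (glueLaw hf s μ μ').map (stateNoise s) = μ.map (stateNoise s) := by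
  have : (stateNoise s : Sample X W → _) ∘ replaceTail s = stateNoise s ∘ Prod.fst :=
    funext fun p => stateNoise_replaceTail s p
  rw [glueLaw, Measure.map_map (by fun_prop) (by fun_prop), this,
    ← Measure.map_map (by fun_prop) (by fun_prop)]
  congr 1
  exact Measure.fst_compProd _ _

theorem blockLaw_zero_glueLaw (hf : Measurable f) (s : ℕ) [IsFiniteMeasure μ]
    [IsFiniteMeasure μ'] : blockLaw f (glueLaw hf s μ μ') 0 s = blockLaw f μ 0 s :=
  map_stateNoise_glueLaw hf s

theorem stateLaw_zero_glueLaw (hf : Measurable f) (s : ℕ) [IsFiniteMeasure μ]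
    [IsFiniteMeasure μ'] : stateLaw f (glueLaw hf s μ μ') 0 = stateLaw f μ 0 := by
  have h := congrArg Measure.fst (map_stateNoise_glueLaw (μ := μ) (μ' := μ') hf s)
  rw [Measure.fst, Measure.fst, Measure.map_map (by fun_prop) (by fun_prop),
    Measure.map_map (by fun_prop) (by fun_prop)] at h
  exact h

theorem blockEntropy_zero_glueLaw (hf : Measurable f) (s : ℕ) [IsFiniteMeasure μ]
    [IsFiniteMeasure μ'] :
    blockEntropy f R (glueLaw hf s μ μ') 0 s = blockEntropy f R μ 0 s := by
  rw [blockEntropy, blockLaw_zero_glueLaw, stateLaw_zero_glueLaw, blockEntropy]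

/-- When the state laws match at the gluing time, `X_s` with the redrawn noise recovers `μ'`
entirely, so state laws of `μ'` carry over to times after `s`. -/
theorem map_shiftSample_glueLaw (hf : Measurable f) (s : ℕ) [IsFiniteMeasure μ]
    [IsFiniteMeasure μ'] (h : stateLaw f μ s = stateLaw f μ' 0) :
    (glueLaw hf s μ μ').map (shiftSample f s) = μ' := by
  have hs := measurable_stateAt hf s
  have h1 : shiftSample f s ∘ replaceTail s =
      fun p : Sample X W × (ℕ → W) => (stateAt f s p.1, p.2) :=
    funext fun p => shiftSample_replaceTail f s p
  have h2 := map_prodMap_compProd_comap (ρ := μ) hs measurable_id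
    (condDistrib Prod.snd Prod.fst μ')
  rw [glueLaw, Measure.map_map (measurable_shiftSample hf s) (by fun_prop), h1]
  refine h2.trans ?_
  rw [Kernel.comap_id, ← stateLaw, h, stateLaw_zero, compProd_map_condDistrib (by fun_prop)]
  exact Measure.map_id

theorem stateLaw_glueLaw (hf : Measurable f) (s k : ℕ) [IsFiniteMeasure μ]
    [IsFiniteMeasure μ'] (h : stateLaw f μ s = stateLaw f μ' 0) :
    stateLaw f (glueLaw hf s μ μ') (s + k) = stateLaw f μ' k := by
  rw [← stateLaw_map_shiftSample hf, map_shiftSample_glueLaw hf s h]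

/-- This records the conditional independence built into the gluing: the kernel sees the past only
through `blockState f s`. -/
theorem pathLaw_glueLaw (hf : Measurable f) (s n : ℕ) [IsFiniteMeasure μ]
    [IsFiniteMeasure μ'] (h : stateLaw f μ s = stateLaw f μ' 0) :
    pathLaw (glueLaw hf s μ μ') s n = μ.map (stateNoise s) ⊗ₘ
      (condDistrib (noiseBlock 0 n) Prod.fst μ').comap (blockState f s)
        (measurable_blockState hf s) := by
  have hb := measurable_blockState hf s
  set κ := condDistrib Prod.snd Prod.fst μ' with hκ
  set T : (ℕ → W) → Fin n → W := fun w i => w i with hT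
  have hTm : Measurable T := by fun_prop
  have hstate : blockState f s ∘ stateNoise s = stateAt f s :=
    funext fun ω => blockState_stateNoise f s ω
  have hpair : (fun ω : Sample X W => (stateNoise s ω, noiseBlock s n ω)) ∘ replaceTail s =
      Prod.map id T ∘ fun p : Sample X W × (ℕ → W) => (stateNoise s p.1, p.2) :=
    funext fun p => Prod.ext (stateNoise_replaceTail s p) (noiseBlock_replaceTail s n p)
  have hglue : (μ ⊗ₘ κ.comap (stateAt f s) (measurable_stateAt hf s)).map
      (fun p => (stateNoise s p.1, p.2)) = μ.map (stateNoise s) ⊗ₘ κ.comap (blockState f s) hb := by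
    rw [← map_prodMap_compProd_comap (measurable_stateNoise s) hb]
    simp only [hstate]
  -- The law of a block is the image of the law of the whole tail only for almost every initial
  -- state of `μ'`; matching state laws carry this over to `P_s`.
  have hae : condDistrib (noiseBlock 0 n) Prod.fst μ' =ᵐ[stateLaw f μ s] κ.map T := by
    have hTn : (noiseBlock 0 n : Sample X W → _) = T ∘ Prod.snd := by
      funext ω i; simp [noiseBlock, hT]
    rw [h, stateLaw_zero, hTn]
    exact condDistrib_comp Prod.fst (by fun_prop) hTm
  rw [pathLaw, glueLaw, Measure.map_map (by fun_prop) (by fun_prop), hpair,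
    ← Measure.map_map (by fun_prop) (by fun_prop), hglue, ← Measure.compProd_map hTm]
  refine Measure.compProd_congr ?_
  rw [← map_blockState_stateNoise hf] at hae
  filter_upwards [ae_of_ae_map hb.aemeasurable hae] with y hy
  rw [← Kernel.comap_map_comm _ hb hTm, Kernel.comap_apply, Kernel.comap_apply, hy]

theorem admissible_glueLaw (hf : Measurable f) (s : ℕ) [IsProbabilityMeasure μ]
    [IsProbabilityMeasure μ'] [IsProbabilityMeasure R] (h : stateLaw f μ s = stateLaw f μ' 0)
    (hμ : Admissible f R μ) (hμ' : Admissible f R μ') :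
    Admissible f R (glueLaw hf s μ μ') := by
  have hb := measurable_blockState hf s
  refine admissible_of_blockLaw_zero hf fun n => ?_
  -- Extending the block to length `s + n` makes it contain the gluing time, where its law factors
  -- into two dominated pieces.
  refine blockLaw_absolutelyContinuous_of_le hf (Nat.le_add_left n s) ?_
  have hκ : ∀ᵐ y ∂(μ.map (stateNoise s)), condDistrib (noiseBlock 0 n) Prod.fst μ'
      (blockState f s y) ≪ Measure.pi fun _ : Fin n => R := by
    have := (blockLaw_absolutelyContinuous_iff 0 n).1 (hμ'.blockLaw_absolutelyContinuous hf 0 n)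
    rw [← h, ← map_blockState_stateNoise hf] at this
    exact ae_of_ae_map hb.aemeasurable this
  have hpath : pathLaw (glueLaw hf s μ μ') s n ≪
      ((stateLaw f μ 0).prod (Measure.pi fun _ : Fin s => R)).prod
        (Measure.pi fun _ : Fin n => R) := by
    rw [pathLaw_glueLaw hf s n h, ← Measure.compProd_const]
    exact Measure.AbsolutelyContinuous.compProd (hμ.blockLaw_absolutelyContinuous hf 0 s) hκ
  have hinv : ∀ m : Measure (X × (Fin (s + n) → W)),
      (m.map (splitBlock s n)).map (fun q => (q.1.1, Fin.append q.1.2 q.2)) = m := fun m => by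
    rw [Measure.map_map (measurable_append s n) (by fun_prop),
      (leftInverse_splitBlock s n).comp_eq_id, Measure.map_id]
  rw [← hinv (blockLaw _ _ _ _), map_splitBlock_blockLaw, stateLaw_zero_glueLaw,
    ← hinv (Measure.prod _ _), map_splitBlock_prod]
  exact hpath.map (measurable_append s n)

theorem pathEntropy_glueLaw [StandardBorelSpace X] (hf : Measurable f) (s n : ℕ)
    [IsProbabilityMeasure μ] [IsProbabilityMeasure μ'] [IsProbabilityMeasure R]
    (h : stateLaw f μ s = stateLaw f μ' 0) :
    pathEntropy R (glueLaw hf s μ μ') s n = blockEntropy f R μ' 0 n := by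
  have hb := measurable_blockState hf s
  have : Nonempty X := (nonempty_of_isProbabilityMeasure μ).map Prod.fst
  have hc : (Kernel.const X (Measure.pi fun _ : Fin n => R)).comap (blockState f s) hb =
    Kernel.const _ (Measure.pi fun _ : Fin n => R) := rfl
  rw [pathEntropy, pathLaw_glueLaw hf s n h, map_stateNoise_glueLaw, ← Measure.compProd_const,
    ← hc, klDiv_compProd_comap hb, map_blockState_stateNoise hf, h, Measure.compProd_const,
    blockEntropy, blockLaw_eq_compProd]
  rfl

theorem blockEntropy_glueLaw [StandardBorelSpace X] (hf : Measurable f) (s n : ℕ)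
    [IsProbabilityMeasure μ] [IsProbabilityMeasure μ'] [IsProbabilityMeasure R]
    (h : stateLaw f μ s = stateLaw f μ' 0) :
    blockEntropy f R (glueLaw hf s μ μ') 0 (s + n) =
      blockEntropy f R μ 0 s + blockEntropy f R μ' 0 n := by
  rw [blockEntropy_add, blockEntropy_zero_glueLaw, pathEntropy_glueLaw hf s n h]

end Glue

end ShiftAndGlue

/-! ### Dynamic programming and the Markov property. -/

section Bellman

variable {X W : Type*} [MeasurableSpace X] [MeasurableSpace W] [StandardBorelSpace W] [Nonempty W]
  {f : X × W → X} {R : Measure W} {Φ Ψ Θ : Measure X} {μ μ' : Measure (Sample X W)}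

theorem minSupply_le [IsProbabilityMeasure μ] {t : ℕ} (h : Steers f R t Φ Ψ μ) :
    minSupply f R t Φ Ψ ≤ supply f R μ 0 t :=
  iInf_le_of_le μ (iInf_le_of_le inferInstance (iInf_le_of_le h le_rfl))

theorem Steers.glueLaw [IsProbabilityMeasure μ] [IsProbabilityMeasure μ'] [IsProbabilityMeasure R]
    (hf : Measurable f) {s n : ℕ} (h : Steers f R s Φ Θ μ) (h' : Steers f R n Θ Ψ μ') :
    Steers f R (s + n) Φ Ψ (glueLaw hf s μ μ') := by
  have hst : stateLaw f μ s = stateLaw f μ' 0 := h.terminal.trans h'.initial.symm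
  exact ⟨admissible_glueLaw hf s hst h.admissible h'.admissible,
    (stateLaw_zero_glueLaw hf s).trans h.initial,
    (stateLaw_glueLaw hf s n hst).trans h'.terminal⟩

theorem Steers.map_shiftSample [IsProbabilityMeasure μ] [IsProbabilityMeasure R]
    (hf : Measurable f) {s n : ℕ} (h : Steers f R (s + n) Φ Ψ μ) :
    Steers f R n (stateLaw f μ s) Ψ (μ.map (shiftSample f s)) :=
  ⟨h.admissible.map_shiftSample hf s, stateLaw_map_shiftSample hf s 0,
    (stateLaw_map_shiftSample hf s n).trans h.terminal⟩

theorem minSupply_add_le [StandardBorelSpace X] [IsProbabilityMeasure R] (hf : Measurable f)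
    {s n : ℕ} (hs : 0 < s) (hn : 0 < n) :
    minSupply f R (s + n) Φ Ψ ≤ minSupply f R s Φ Θ + minSupply f R n Θ Ψ := by
  conv_rhs => rw [minSupply, minSupply]
  -- Pulling both infima out of the sum leaves an arbitrary pair of noises to glue; no minimiser is
  -- needed.
  simp only [ENNReal.iInf_add, ENNReal.add_iInf]
  refine le_iInf fun μ' => le_iInf fun _ => le_iInf fun h' => ?_
  refine le_iInf fun μ => le_iInf fun _ => le_iInf fun h => ?_
  have hg := h.glueLaw hf h'
  refine (minSupply_le hg).trans_eq ?_
  rw [hg.admissible.supply_eq (by omega), h.admissible.supply_eq hs, h'.admissible.supply_eq hn]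
  exact blockEntropy_glueLaw hf s n (h.terminal.trans h'.initial.symm)

/-- The dynamic programming principle for the minimum required supply. -/
theorem minSupply_add_eq [StandardBorelSpace X] [IsProbabilityMeasure R] (hf : Measurable f)
    {Pstar : Measure X} [IsProbabilityMeasure Pstar] (hinv : (Pstar.prod R).map f = Pstar)
    (hΦ : Φ ≪ Pstar) (hΨ : Ψ ≪ Pstar) {s n : ℕ} (hs : 0 < s) (hn : 0 < n) :
    minSupply f R (s + n) Φ Ψ = infOverIntermediate f R Pstar s n Φ Ψ := by
  refine le_antisymm ?_ ?_
  · exact le_iInf fun Θ => le_iInf fun _ => le_iInf fun _ => le_iInf fun _ =>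
      minSupply_add_le hf hs hn
  · refine le_iInf fun μ => le_iInf fun _ => le_iInf fun h => ?_
    -- A finite supply is needed to make `P_s` a reachable intermediate law.
    rcases eq_or_ne (supply f R μ 0 (s + n)) ∞ with htop | hfin
    · rw [htop]; exact le_top
    have h1 : Steers f R s Φ (stateLaw f μ s) μ := ⟨h.admissible, h.initial, rfl⟩
    have : IsProbabilityMeasure (μ.map (shiftSample f s)) :=
      Measure.isProbabilityMeasure_map (measurable_shiftSample hf s).aemeasurable
    have h2 := h.map_shiftSample hf
    have hsum : supply f R μ 0 s + supply f R (μ.map (shiftSample f s)) 0 n ≤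
        supply f R μ 0 (s + n) := by
      rw [h.admissible.supply_eq hs, h2.admissible.supply_eq hn,
        h.admissible.supply_eq (by omega)]
      refine le_trans ?_ (blockEntropy_add (f := f) (R := R) (μ := μ) s n).ge
      refine add_le_add le_rfl ?_
      exact (blockEntropy_map_shiftSample hf s n).trans_le (blockEntropy_le_pathEntropy hf s n)
    have hle : minSupply f R s Φ (stateLaw f μ s) + minSupply f R n (stateLaw f μ s) Ψ ≤
        supply f R μ 0 (s + n) :=
      (add_le_add (minSupply_le h1) (minSupply_le h2)).trans hsum
    have hlt := ENNReal.add_lt_top.1 (hle.trans_lt hfin.lt_top)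
    have hac : stateLaw f μ s ≪ Pstar :=
      h.admissible.stateLaw_absolutelyContinuous hf hinv (h.initial ▸ hΦ) s
    exact iInf_le_of_le (stateLaw f μ s) (iInf_le_of_le (isProbabilityMeasure_stateLaw hf s)
      (iInf_le_of_le ⟨hΦ, hac, hlt.1⟩ (iInf_le_of_le ⟨hac, hΨ, hlt.2⟩ hle)))

/-- If the past is independent of the future noise given the state, then so is the next noise. -/
theorem condDistrib_noise_eq_of_pathLaw_eq [IsFiniteMeasure μ] (hf : Measurable f) {k n : ℕ}
    (hn : 0 < n)
    (h : pathLaw μ k n = μ.map (stateNoise k) ⊗ₘ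
      (condDistrib (noiseBlock k n) (stateAt f k) μ).comap (blockState f k)
        (measurable_blockState hf k)) :
    ∀ᵐ ω ∂μ, condDistrib (fun ω' : Sample X W => ω'.2 k) (stateNoise k) μ (stateNoise k ω) =
      condDistrib (fun ω' : Sample X W => ω'.2 k) (stateAt f k) μ (stateAt f k ω) := by
  have hb := measurable_blockState hf k
  have hs := measurable_stateAt hf k
  have hev : Measurable fun w : Fin n → W => w ⟨0, hn⟩ := measurable_pi_apply _
  have hcomp : (fun ω' : Sample X W => ω'.2 k) = (fun w : Fin n → W => w ⟨0, hn⟩) ∘ noiseBlock k n :=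
    rfl
  have hstate : condDistrib (fun ω' : Sample X W => ω'.2 k) (stateAt f k) μ =ᵐ[μ.map (stateAt f k)]
      (condDistrib (noiseBlock k n) (stateAt f k) μ).map fun w => w ⟨0, hn⟩ := by
    rw [hcomp]
    exact condDistrib_comp _ (by fun_prop) hev
  have hblock : condDistrib (noiseBlock k n) (stateNoise k) μ =ᵐ[μ.map (stateNoise k)]
      (condDistrib (noiseBlock k n) (stateAt f k) μ).comap (blockState f k) hb :=
    condDistrib_ae_eq_of_measure_eq_compProd _ (by fun_prop) h
  have hpast : condDistrib (fun ω' : Sample X W => ω'.2 k) (stateNoise k) μ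
      =ᵐ[μ.map (stateNoise k)]
      (condDistrib (noiseBlock k n) (stateNoise k) μ).map fun w => w ⟨0, hn⟩ := by
    rw [hcomp]
    exact condDistrib_comp _ (by fun_prop) hev
  filter_upwards [ae_of_ae_map hs.aemeasurable hstate,
    ae_of_ae_map (measurable_stateNoise k).aemeasurable hblock,
    ae_of_ae_map (measurable_stateNoise k).aemeasurable hpast] with ω h1 h2 h3
  rw [h1, h3, Kernel.map_apply _ hev, Kernel.map_apply _ hev, h2, Kernel.comap_apply,
    blockState_stateNoise]

/-- The competitor redraws all the noise left after time `k` given `X_k`, using the optimal noise's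
own conditional law; optimality then yields independence of the past for the whole remaining block,
and so for `W_k`. -/
theorem IsOptimal.isMarkovNoise [StandardBorelSpace X] [IsProbabilityMeasure R]
    [IsProbabilityMeasure μ] (hf : Measurable f) {t : ℕ} (h : IsOptimal f R t Φ Ψ μ) :
    IsMarkovNoise f t μ := by
  intro k hk
  obtain ⟨n, rfl⟩ := Nat.exists_eq_add_of_le hk.le
  have hn : 0 < n := by omega
  refine condDistrib_noise_eq_of_pathLaw_eq hf hn ?_
  have hb := measurable_blockState hf k
  have : Nonempty X := (nonempty_of_isProbabilityMeasure μ).map Prod.fst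
  have : IsProbabilityMeasure (μ.map (shiftSample f k)) :=
    Measure.isProbabilityMeasure_map (measurable_shiftSample hf k).aemeasurable
  have h1 : Steers f R k Φ (stateLaw f μ k) μ := ⟨h.steers.admissible, h.steers.initial, rfl⟩
  have h2 := h.steers.map_shiftSample hf
  have hg := h1.glueLaw hf h2
  -- The prefix term stays a `blockEntropy`: `k` may be `0`, where `supply_eq` does not apply.
  have hopt : supply f R μ 0 (k + n) = blockEntropy f R μ 0 k + pathEntropy R μ k n :=
    (h.steers.admissible.supply_eq (by omega)).trans (blockEntropy_add k n)
  have hglue : supply f R (_root_.glueLaw hf k μ (μ.map (shiftSample f k))) 0 (k + n) =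
      blockEntropy f R μ 0 k + blockEntropy f R μ k n := by
    rw [hg.admissible.supply_eq (by omega), ← blockEntropy_map_shiftSample hf k n]
    exact blockEntropy_glueLaw hf k n h2.initial.symm
  have hfin := h.finite
  have hle := h.attains.trans_le (minSupply_le hg)
  rw [← h.attains, hopt, ENNReal.add_lt_top] at hfin
  -- The common prefix entropy is finite and cancels, leaving the reverse of the data processing
  -- inequality.
  rw [hopt, hglue, ENNReal.add_le_add_iff_left hfin.1.ne] at hle
  refine eq_compProd_comap_of_klDiv_le (r := Measure.pi fun _ : Fin n => R) hb ?_ hfin.2.ne ?_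
  · rw [map_blockState_pathLaw hf, map_blockState_stateNoise hf, blockLaw_eq_compProd]
  · rw [map_blockState_pathLaw hf, map_blockState_stateNoise hf]
    exact hle

end Bellman

theorem theorem7p1
    {X W : Type*}
    [TopologicalSpace X] [PolishSpace X] [MeasurableSpace X] [BorelSpace X]
    [TopologicalSpace W] [PolishSpace W] [MeasurableSpace W] [BorelSpace W] [Nonempty W]
    (f : X × W → X) (hf : Measurable f)
    (R : Measure W) [IsProbabilityMeasure R]
    (Pstar : Measure X) [IsProbabilityMeasure Pstar]
    (hinv : (Pstar.prod R).map f = Pstar)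
    (Φ Ψ : Measure X) [IsProbabilityMeasure Φ] [IsProbabilityMeasure Ψ]
    (hΦ : Φ ≪ Pstar) (hΨ : Ψ ≪ Pstar) :
    (∀ s t : ℕ, 0 < s → s < t →
      minSupply f R t Φ Ψ = infOverIntermediate f R Pstar s (t - s) Φ Ψ) ∧
    (∀ t : ℕ, 0 < t →
      minSupply f R (t + 1) Φ Ψ = infOverIntermediate f R Pstar 1 t Φ Ψ ∧
      minSupply f R (t + 1) Φ Ψ = infOverIntermediate f R Pstar t 1 Φ Ψ) ∧
    (∀ t : ℕ, 0 < t → ∀ (μ : Measure (Sample X W)) [IsProbabilityMeasure μ],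
      IsOptimal f R t Φ Ψ μ → IsMarkovNoise f t μ) := by
  refine ⟨fun s t hs hst => ?_, fun t ht => ⟨?_, ?_⟩, fun t _ μ _ h => h.isMarkovNoise hf⟩
  · obtain ⟨n, rfl⟩ := Nat.exists_eq_add_of_le hst.le
    rw [Nat.add_sub_cancel_left]
    exact minSupply_add_eq hf hinv hΦ hΨ hs (by omega)
  · rw [Nat.add_comm]
    exact minSupply_add_eq hf hinv hΦ hΨ one_pos ht
  · exact minSupply_add_eq hf hinv hΦ hΨ ht one_pos
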